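/- Let $B\ge 2$ be a fixed integer. For an odd number $n$ of real data points $x_1,\dots,x_n$ with mean $\hat\mu=\frac1n\sum_i x_i$ and standard deviation $\hat\sigma=\big(\frac1n\sum_i(x_i-\hat\mu)^2\big)^{1/2}$, the algorithm binmedian works as follows. It starts with all $n$ points, with the interval $[\hat\mu-\hat\sigma,\hat\mu+\hat\sigma]$, and with $N_L$ the number of data points to the left of this interval. In each iteration, the current interval is divided into $B$ bins of equal length, numbered $0,\dots,B-1$ from left to right (half-open on the right, except that the last one is closed); the numbers $N_0,\dots,N_{B-1}$ of remaining points in the bins are counted; the median bin $b$ is the least index with $N_L+N_0+\dots+N_b\ge (n+1)/2$; $N_L$ is increased by $N_0+\dots+N_{b-1}$, and only the points in bin $b$ are kept. The next interval is bin $b$, except that, if no remaining point has been excluded in this iteration, it is the interval from the least to the greatest remaining point. The algorithm stops when only one point is left. Let $N^{(j)}$ be the number of points remaining at the start of the $j$-th iteration ($N^{(0)}=n$), and let $T\in\{0,1,2,\dots\}\cup\{\infty\}$ be the number of iterations before termination. An iteration with $N$ remaining points is charged $N+B$ operations, so that the running time is $R(x_1,\dots,x_n)=\sum_{j=0}^{T}\big(N^{(j)}+B\big)$.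 Let $\nu$ be a probability distribution on $\mathbb R$ that has a bounded density $f$ with respect to Lebesgue measure and satisfies $\int y^4\,d\nu(y)<\infty$. Then there is a constant $K<\infty$, depending only on $B$ and $\nu$, such that for every odd $n$ and all independent random variables $X_1,\dots,X_n$ with distribution $\nu$, $$\mathbb E\,R(X_1,\dots,X_n)\le K\,n .$$ That is, the expected running time of binmedian, averaged over draws of the data, is $O(n)$. -/

import Mathlib

open MeasureTheory ProbabilityTheory
open scoped ENNReal NNReal

noncomputable section

namespace Binmedian

/-- The mean of the data points `x 0, …, x (n - 1)`. -/
def mean {n : ℕ} (x : Fin n → ℝ) : ℝ := (∑ i, x i) / n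

/-- The standard deviation (with normalization `1 / n`) of the data points. -/
def stdDev {n : ℕ} (x : Fin n → ℝ) : ℝ := √((∑ i, (x i - mean x) ^ 2) / n)

/-- A state of the algorithm: the interval `[lo, hi]` across which the next bins are formed, the
(indices of the) data points that remain, and the number `left` of data points that lie to the
left of the interval (the count `N_L`). -/
structure State (n : ℕ) where
  lo : ℝ
  hi : ℝ
  pts : Finset (Fin n)
  left : ℕ

/-- The `i`-th endpoint of the `B` equally spaced bins across `[lo, hi]`. -/
def edge (B : ℕ) (lo hi : ℝ) (i : ℕ) : ℝ := lo + (i : ℝ) / B * (hi - lo)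

/-- `y` lies in the `i`-th of the `B` bins across `[lo, hi]`. The bins are half-open, except that
the last one also contains the right endpoint. -/
def InBin (B : ℕ) (lo hi : ℝ) (i : ℕ) (y : ℝ) : Prop :=
  edge B lo hi i ≤ y ∧ (y < edge B lo hi (i + 1) ∨ (i + 1 = B ∧ y ≤ hi))

/-- The remaining data points that are mapped to bin `i`. -/
def bin (B : ℕ) {n : ℕ} (x : Fin n → ℝ) (s : State n) (i : ℕ) : Finset (Fin n) :=
  open Classical in s.pts.filter fun k => InBin B s.lo s.hi i (x k)

/-- The median bin: the least `b` in `{0, …, B - 1}` with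
`N_L + N_0 + ⋯ + N_b ≥ (n + 1) / 2`, where `N_i` is the number of points mapped to bin `i`. -/
def medianBin (B : ℕ) {n : ℕ} (x : Fin n → ℝ) (s : State n) : ℕ :=
  sInf {b : ℕ | b < B ∧ (n + 1) / 2 ≤ s.left + ∑ i ∈ Finset.range (b + 1), (bin B x s i).card}

/-- The initial state: all points, with bins to be formed across `[mean - stdDev, mean + stdDev]`. -/
def init {n : ℕ} (x : Fin n → ℝ) : State n where
  lo := mean x - stdDev x
  hi := mean x + stdDev x
  pts := Finset.univ
  left := open Classical in (Finset.univ.filter fun k => x k < mean x - stdDev x).card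

/-- One iteration: form the bins, find the median bin `b`, keep only the points mapped to `b`. The
next bins are formed across `b`, unless no point has been excluded, in which case they are formed
across the interval from the least to the greatest remaining point. -/
def step (B : ℕ) {n : ℕ} (x : Fin n → ℝ) (s : State n) : State n :=
  let b := medianBin B x s
  let S := bin B x s b
  open Classical in
  { lo := if S = s.pts then sInf (x '' (S : Set (Fin n))) else edge B s.lo s.hi b
    hi := if S = s.pts then sSup (x '' (S : Set (Fin n))) else edge B s.lo s.hi (b + 1)
    pts := S
    left := s.left + ∑ i ∈ Finset.range b, (bin B x s i).card }

/-- The state at the `j`-th iteration. -/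
def run (B : ℕ) {n : ℕ} (x : Fin n → ℝ) : ℕ → State n
  | 0 => init x
  | j + 1 => step B x (run B x j)

/-- The number `N_j` of points at the `j`-th iteration. -/
def numPts (B : ℕ) {n : ℕ} (x : Fin n → ℝ) (j : ℕ) : ℕ := (run B x j).pts.card

/-- The number `T` of iterations before termination, that is, before there is only one point left;
it is `⊤` if the algorithm does not terminate. -/
def iterations (B : ℕ) {n : ℕ} (x : Fin n → ℝ) : ℕ∞ :=
  ⨅ (j : ℕ) (_ : numPts B x j ≤ 1), (j : ℕ∞)

/-- The running time `∑_{j = 0}^T (N_j + B)`: the `j`-th iteration performs `N_j + B` operations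
(one for each point that is mapped to a bin, and one for each bin count). It is `⊤` if the
algorithm does not terminate. -/
def runtime (B : ℕ) {n : ℕ} (x : Fin n → ℝ) : ℝ≥0∞ :=
  open Classical in
  ∑' j : ℕ, if (j : ℕ∞) ≤ iterations B x then (numPts B x j : ℝ≥0∞) + (B : ℝ≥0∞) else 0

end Binmedian

end

noncomputable section

namespace Binmedian

/-! ### Pointwise bounds, valid for every data set. -/

section Deterministic

variable {B n : ℕ} {x : Fin n → ℝ} {s : State n}

/-! Which bin is selected plays no role in the bound: all that matters is that each iteration
shrinks the interval by a factor of at least `B ≥ 2`. Hence for `j ≥ 1` the survivors lie within `2σ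
/ 2 ^ j` of each other, where `σ` is the empirical standard deviation.

Split on the size of `σ`. If `σ > (5/4) ^ j`, then `n ≤ (16/25) ^ j * ∑ x i ^ 2`, a Chebyshev-type
bound. Otherwise the survivors are within `w = 2 (5/8) ^ j`, and `N ≥ 2` survivors produce `N (N -
1) ≥ N ^ 2 / 2` ordered close pairs. With threshold `r = n (3/4) ^ j`, either `N ≤ r`, or `N ≤ N ^ 2
/ r`, which is at most `2 / r` times the number of close pairs (`numPts_le_closePairs`).

Two independent points with density at most `M` are within `w` with probability at most `2 M w`, so
the expected number of close pairs is at most `n ^ 2 * 2 M w` (`lintegral_closePairs_le`). Therefore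
the expected number of survivors, counted only when there are at least two, is at most `n` times a
sum of three geometric sequences in `j`, with ratios `16/25`, `3/4` and `(5/8) / (3/4) = 5/6`.
Summing over `j` gives `O(n)`; the terminal iteration adds at most `1 + B`. The rates work because
`1 < 5/4 < 2` and `5/8 < 3/4 < 1`. -/

lemma stdDev_nonneg (x : Fin n → ℝ) : 0 ≤ stdDev x := Real.sqrt_nonneg _

/-- The variance times `n` is at most the sum of the squares. -/
lemma card_mul_stdDev_sq_le (x : Fin n → ℝ) : n * stdDev x ^ 2 ≤ ∑ i, x i ^ 2 := by
  rcases Nat.eq_zero_or_pos n with rfl | hn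
  · simp
  have hn' : (0 : ℝ) < n := by exact_mod_cast hn
  have hsum : ∑ i, x i = n * mean x := by
    unfold mean; field_simp
  have hsq : stdDev x ^ 2 = (∑ i, (x i - mean x) ^ 2) / n :=
    Real.sq_sqrt (div_nonneg (Finset.sum_nonneg fun i _ => sq_nonneg _) hn'.le)
  have hexp : ∑ i, (x i - mean x) ^ 2 = ∑ i, x i ^ 2 - n * mean x ^ 2 := by
    have h1 : ∑ i, (x i - mean x) ^ 2
        = ∑ i, x i ^ 2 - 2 * mean x * ∑ i, x i + n * mean x ^ 2 := by
      simp only [sub_sq, Finset.sum_add_distrib, Finset.sum_sub_distrib, Finset.mul_sum]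
      simp
      exact Finset.sum_congr rfl fun i _ => by ring
    rw [h1, hsum]; ring
  rw [hsq, mul_div_cancel₀ _ hn'.ne', hexp]
  nlinarith [mul_nonneg hn'.le (sq_nonneg (mean x))]

lemma edge_succ_sub_edge (B : ℕ) (lo hi : ℝ) (i : ℕ) :
    edge B lo hi (i + 1) - edge B lo hi i = (hi - lo) / B := by
  unfold edge; push_cast; ring

lemma edge_self (hB : 0 < B) (lo hi : ℝ) : edge B lo hi B = hi := by
  have : (B : ℝ) ≠ 0 := by exact_mod_cast hB.ne'
  unfold edge; rw [div_self this]; ring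

lemma InBin.mem_Icc (hB : 0 < B) {lo hi y : ℝ} {i : ℕ} (h : InBin B lo hi i y) :
    y ∈ Set.Icc (edge B lo hi i) (edge B lo hi (i + 1)) := by
  refine ⟨h.1, ?_⟩
  rcases h.2 with h | ⟨h, h'⟩
  · exact h.le
  · rwa [h, edge_self hB]

lemma mem_bin {i : ℕ} {k : Fin n} :
    k ∈ bin B x s i ↔ k ∈ s.pts ∧ InBin B s.lo s.hi i (x k) := by
  simp [bin]

lemma step_pts_mem_Icc (hB : 0 < B) {k : Fin n} (hk : k ∈ (step B x s).pts) :
    x k ∈ Set.Icc (step B x s).lo (step B x s).hi := by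
  have hk' : k ∈ bin B x s (medianBin B x s) := hk
  simp only [step]
  split_ifs with h
  · have hfin : (x '' (bin B x s (medianBin B x s) : Set (Fin n))).Finite :=
      (Finset.finite_toSet _).image _
    have hm : x k ∈ x '' (bin B x s (medianBin B x s) : Set (Fin n)) := ⟨k, hk', rfl⟩
    exact ⟨csInf_le hfin.bddBelow hm, le_csSup hfin.bddAbove hm⟩
  · exact (mem_bin.1 hk').2.mem_Icc hB

/-- Refitting the interval to the extreme points cannot widen it beyond the bin, since those points
already lie in that bin. -/
lemma step_width_le (hB : 0 < B) (hs : s.lo ≤ s.hi) :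
    (step B x s).lo ≤ (step B x s).hi ∧
      (step B x s).hi - (step B x s).lo ≤ (s.hi - s.lo) / B := by
  have hw : 0 ≤ (s.hi - s.lo) / B := div_nonneg (sub_nonneg.2 hs) (Nat.cast_nonneg _)
  have he := edge_succ_sub_edge B s.lo s.hi (medianBin B x s)
  simp only [step]
  split_ifs with h
  · rcases (bin B x s (medianBin B x s)).eq_empty_or_nonempty with h0 | h0
    -- Here both endpoints take the default value `sInf ∅ = sSup ∅ = 0`, so the width is zero.
    · simp [h0, hw]
    have hne : (x '' (bin B x s (medianBin B x s) : Set (Fin n))).Nonempty :=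
      Set.Nonempty.image x h0
    have hmem : ∀ y ∈ x '' (bin B x s (medianBin B x s) : Set (Fin n)),
        y ∈ Set.Icc (edge B s.lo s.hi (medianBin B x s))
          (edge B s.lo s.hi (medianBin B x s + 1)) := by
      rintro _ ⟨k, hk, rfl⟩
      exact (mem_bin.1 hk).2.mem_Icc hB
    have hfin : (x '' (bin B x s (medianBin B x s) : Set (Fin n))).Finite :=
      (Finset.finite_toSet _).image _
    refine ⟨csInf_le_csSup hne hfin.bddBelow hfin.bddAbove, ?_⟩
    have h1 := le_csInf hne fun y hy => (hmem y hy).1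
    have h2 := csSup_le hne fun y hy => (hmem y hy).2
    linarith
  · exact ⟨by linarith, he.le⟩

lemma run_width_le (hB : 0 < B) (x : Fin n → ℝ) (j : ℕ) :
    (run B x j).lo ≤ (run B x j).hi ∧
      (run B x j).hi - (run B x j).lo ≤ 2 * stdDev x / (B : ℝ) ^ j := by
  induction j with
  | zero =>
    have := stdDev_nonneg x
    unfold run init
    constructor
    · linarith
    · simp; linarith
  | succ j ih =>
    obtain ⟨h1, h2⟩ := step_width_le (x := x) hB ih.1
    refine ⟨h1, h2.trans ?_⟩
    rw [pow_succ, ← div_div]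
    exact div_le_div_of_nonneg_right ih.2 (Nat.cast_nonneg _)

/-- After `j ≥ 1` iterations the remaining points are within `2 * stdDev / B ^ j` of each other. -/
lemma abs_sub_le_of_mem_run (hB : 0 < B) {j : ℕ} (hj : j ≠ 0) {i k : Fin n}
    (hi : i ∈ (run B x j).pts) (hk : k ∈ (run B x j).pts) :
    |x i - x k| ≤ 2 * stdDev x / (B : ℝ) ^ j := by
  obtain ⟨j, rfl⟩ := Nat.exists_eq_succ_of_ne_zero hj
  have h1 := step_pts_mem_Icc hB hi
  have h2 := step_pts_mem_Icc hB hk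
  have h3 := (run_width_le hB x (j + 1)).2
  have h4 : (run B x (j + 1)) = step B x (run B x j) := rfl
  rw [h4] at h3
  rw [Nat.succ_eq_add_one, abs_le]
  constructor <;> linarith [h1.1, h1.2, h2.1, h2.2]

/-- The number of ordered pairs of distinct indices whose data points are within `w`. -/
def closePairs (w : ℝ) (x : Fin n → ℝ) : ℝ :=
  open Classical in
  ∑ p ∈ (Finset.univ : Finset (Fin n)).offDiag, if |x p.1 - x p.2| ≤ w then 1 else 0

lemma closePairs_nonneg (w : ℝ) (x : Fin n → ℝ) : 0 ≤ closePairs w x :=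
  Finset.sum_nonneg fun _ _ => by split_ifs <;> norm_num

/-- All `N (N - 1)` ordered pairs from `S` are close, and `N ^ 2 ≤ 2 N (N - 1)` once `N ≥ 2`. -/
lemma card_sq_le_closePairs {w : ℝ} {S : Finset (Fin n)} (hS : 2 ≤ S.card)
    (h : ∀ i ∈ S, ∀ k ∈ S, |x i - x k| ≤ w) :
    (S.card : ℝ) ^ 2 ≤ 2 * closePairs w x := by
  classical
  have h1 : (S.offDiag.card : ℝ) ≤ closePairs w x := by
    unfold closePairs
    calc (S.offDiag.card : ℝ) = ∑ p ∈ S.offDiag, (1 : ℝ) := by simp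
      _ = ∑ p ∈ S.offDiag, if |x p.1 - x p.2| ≤ w then (1 : ℝ) else 0 := by
        refine Finset.sum_congr rfl fun p hp => ?_
        rw [Finset.mem_offDiag] at hp
        rw [if_pos (h _ hp.1 _ hp.2.1)]
      _ ≤ _ := by
        refine Finset.sum_le_sum_of_subset_of_nonneg
          (Finset.offDiag_mono (Finset.subset_univ S)) fun p _ _ => ?_
        split_ifs <;> norm_num
  rw [Finset.offDiag_card, Nat.cast_sub (Nat.le_mul_self _)] at h1
  push_cast at h1
  have h2 : (2 : ℝ) ≤ S.card := by exact_mod_cast hS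
  nlinarith

lemma numPts_le (x : Fin n → ℝ) (j : ℕ) : numPts B x j ≤ n := by
  simpa [numPts] using Finset.card_le_univ (run B x j).pts

/-- A pointwise bound for the number of points at the `j`-th iteration, if there are at least two. -/
lemma numPts_le_closePairs (hB : 2 ≤ B) (hn : 0 < n) (x : Fin n → ℝ) (j : ℕ)
    (h2 : 2 ≤ numPts B x j) :
    (numPts B x j : ℝ) ≤ (16 / 25) ^ j * ∑ i, x i ^ 2 + n * (3 / 4) ^ j
      + 2 / (n * (3 / 4) ^ j) * closePairs (2 * (5 / 8) ^ j) x := by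
  have hn' : (0 : ℝ) < n := by exact_mod_cast hn
  have hN : (numPts B x j : ℝ) ≤ n := by exact_mod_cast numPts_le x j
  have hr : (0 : ℝ) < n * (3 / 4) ^ j := by positivity
  have hc := closePairs_nonneg (2 * (5 / 8) ^ j) x
  have hq : 0 ≤ ∑ i, x i ^ 2 := Finset.sum_nonneg fun i _ => sq_nonneg _
  have t1 : 0 ≤ (16 / 25 : ℝ) ^ j * ∑ i, x i ^ 2 := by positivity
  have t3 : 0 ≤ 2 / (n * (3 / 4) ^ j) * closePairs (2 * (5 / 8) ^ j) x := by positivity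
  -- The initial points need not lie in the initial interval, so `j = 0` is separate; there the
  -- middle term is already `n`.
  rcases eq_or_ne j 0 with rfl | hj
  · simp only [pow_zero, mul_one, one_mul] at *
    linarith
  by_cases hσ : stdDev x ≤ (5 / 4) ^ j
  · have hw : 2 * stdDev x / (B : ℝ) ^ j ≤ 2 * (5 / 8) ^ j := by
      have hB' : (2 : ℝ) ^ j ≤ (B : ℝ) ^ j := by
        gcongr; exact_mod_cast hB
      calc 2 * stdDev x / (B : ℝ) ^ j ≤ 2 * (5 / 4) ^ j / 2 ^ j := by gcongr
        _ = 2 * (5 / 8) ^ j := by rw [mul_div_assoc, ← div_pow]; norm_num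
    have hsq := card_sq_le_closePairs (x := x) h2 fun i hi k hk =>
      (abs_sub_le_of_mem_run (by lia) hj hi hk).trans hw
    change (numPts B x j : ℝ) ^ 2 ≤ _ at hsq
    by_cases hle : (numPts B x j : ℝ) ≤ n * (3 / 4) ^ j
    · linarith
    -- Above the threshold `r`, one has `N * r ≤ N ^ 2`.
    · have : (numPts B x j : ℝ) ≤ 2 / (n * (3 / 4) ^ j) * closePairs (2 * (5 / 8) ^ j) x := by
        rw [div_mul_eq_mul_div, le_div_iff₀ hr]
        nlinarith
      linarith
  · have h1 : ((5 / 4 : ℝ) ^ j) ^ 2 ≤ stdDev x ^ 2 := by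
      have := not_le.1 hσ
      gcongr
    have h3 : (1 : ℝ) ≤ (16 / 25) ^ j * stdDev x ^ 2 := by
      calc (1 : ℝ) = (16 / 25) ^ j * ((5 / 4 : ℝ) ^ j) ^ 2 := by
            rw [pow_right_comm, ← mul_pow]; norm_num
        _ ≤ _ := by gcongr
    have h4 := card_mul_stdDev_sq_le x
    have : (n : ℝ) ≤ (16 / 25) ^ j * ∑ i, x i ^ 2 := by
      calc (n : ℝ) ≤ n * ((16 / 25) ^ j * stdDev x ^ 2) := le_mul_of_one_le_right hn'.le h3
        _ = (16 / 25) ^ j * (n * stdDev x ^ 2) := by ring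
        _ ≤ _ := by gcongr
    linarith

lemma coe_le_iterations {j : ℕ} :
    (j : ℕ∞) ≤ iterations B x ↔ ∀ i, numPts B x i ≤ 1 → j ≤ i := by
  simp [iterations, le_iInf_iff]

/-- At most one charged iteration, the terminal one, has at most one point; it costs at most `1 +
B`. Every other charged iteration has `N ≥ 2`, so `N + B ≤ (1 + B) * N`. -/
lemma runtime_le (x : Fin n → ℝ) :
    runtime B x ≤ (1 + B) +
      ∑' j, (1 + B) * (if 2 ≤ numPts B x j then (numPts B x j : ℝ≥0∞) else 0) := by
  classical
  have hlast : ∑' j : ℕ, (if (j : ℕ∞) ≤ iterations B x ∧ numPts B x j ≤ 1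
      then (1 + B : ℝ≥0∞) else 0) ≤ 1 + B := by
    by_cases h : ∃ j, numPts B x j ≤ 1
    · calc _ ≤ ∑' j : ℕ, (if j = Nat.find h then (1 + B : ℝ≥0∞) else 0) := by
            refine ENNReal.tsum_le_tsum fun j => ?_
            split_ifs with h1 h2
            · exact le_rfl
            · exact absurd (le_antisymm (coe_le_iterations.1 h1.1 _ (Nat.find_spec h))
                (Nat.find_min' h h1.2)) h2
            · exact zero_le
            · exact le_rfl
        _ = _ := by rw [tsum_ite_eq]
    · have : ∀ j : ℕ, ¬ ((j : ℕ∞) ≤ iterations B x ∧ numPts B x j ≤ 1) := fun j hj => h ⟨j, hj.2⟩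
      simp [this]
  calc runtime B x ≤ ∑' j : ℕ, ((if (j : ℕ∞) ≤ iterations B x ∧ numPts B x j ≤ 1
      then (1 + B : ℝ≥0∞) else 0)
      + (1 + B) * (if 2 ≤ numPts B x j then (numPts B x j : ℝ≥0∞) else 0)) := by
        refine ENNReal.tsum_le_tsum fun j => ?_
        by_cases hj : (j : ℕ∞) ≤ iterations B x
        · by_cases h1 : numPts B x j ≤ 1
          · have h2 : ¬ 2 ≤ numPts B x j := by lia
            have : (numPts B x j : ℝ≥0∞) ≤ 1 := by exact_mod_cast h1
            simp only [hj, h1, h2, if_true, if_false, and_self, mul_zero, add_zero]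
            gcongr
          · have h2 : 2 ≤ numPts B x j := by lia
            simp only [hj, h1, h2, if_true, if_false, and_false, zero_add]
            have : numPts B x j + B ≤ (1 + B) * numPts B x j := by nlinarith
            exact_mod_cast this
        · simp [hj]
    _ ≤ _ := by
        rw [ENNReal.tsum_add]
        gcongr

end Deterministic

/-! ### Measurability of the algorithm's states and running time in the data. -/

section Measurability

variable {B n : ℕ}

lemma measurable_mean : Measurable (mean : (Fin n → ℝ) → ℝ) := by
  unfold mean; fun_prop

lemma measurable_stdDev : Measurable (stdDev : (Fin n → ℝ) → ℝ) := by
  have := measurable_mean (n := n)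
  unfold stdDev; fun_prop

/-- Measurability of a state that depends on the data. -/
structure MeasurableState (s : (Fin n → ℝ) → State n) : Prop where
  lo : Measurable fun x => (s x).lo
  hi : Measurable fun x => (s x).hi
  pts : Measurable[_, ⊤] fun x => (s x).pts
  left : Measurable fun x => (s x).left

/-- Lets the discrete choices (median bin, set of survivors) be frozen: it suffices to treat each of
their countably many values separately. -/
lemma measurable_comp_countable {α β γ : Type*} [MeasurableSpace α] [MeasurableSpace γ]
    [Countable β] {g : α → β} (hg : Measurable[_, ⊤] g) {F : β → α → γ}
    (hF : ∀ b, Measurable (F b)) : Measurable fun a => F (g a) a := by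
  let : MeasurableSpace β := ⊤
  intro t ht
  have : (fun a => F (g a) a) ⁻¹' t = ⋃ b, g ⁻¹' {b} ∩ F b ⁻¹' t := by
    ext a; simp
  rw [this]
  exact MeasurableSet.iUnion fun b => (hg trivial).inter (hF b ht)

lemma measurable_finset {α : Type*} [MeasurableSpace α] {S : α → Finset (Fin n)}
    (h : ∀ k, MeasurableSet {a | k ∈ S a}) : Measurable[_, ⊤] S := by
  let : MeasurableSpace (Finset (Fin n)) := ⊤
  refine measurable_to_countable' fun T => ?_
  have : S ⁻¹' {T} = ⋂ k, {a | k ∈ S a ↔ k ∈ T} := by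
    ext a; simp [Finset.ext_iff]
  rw [this]
  refine MeasurableSet.iInter fun k => ?_
  by_cases hk : k ∈ T
  · simpa [hk] using h k
  · simp only [hk, iff_false]
    exact (h k).compl

lemma measurable_edge {lo hi : (Fin n → ℝ) → ℝ} (hlo : Measurable lo) (hhi : Measurable hi)
    (i : ℕ) : Measurable fun x => edge B (lo x) (hi x) i := by
  unfold edge; fun_prop

variable {s : (Fin n → ℝ) → State n}

lemma MeasurableState.bin (hs : MeasurableState s) (i : ℕ) :
    Measurable[_, ⊤] fun x => bin B x (s x) i := by
  refine measurable_finset fun k => ?_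
  simp only [mem_bin, InBin]
  have hp : MeasurableSet {x | k ∈ (s x).pts} := hs.pts (t := {T | k ∈ T}) trivial
  have hx : Measurable fun x : Fin n → ℝ => x k := measurable_pi_apply k
  exact hp.inter ((measurableSet_le (measurable_edge hs.lo hs.hi i) hx).inter
    ((measurableSet_lt hx (measurable_edge hs.lo hs.hi (i + 1))).union
      ((MeasurableSet.const _).inter (measurableSet_le hx hs.hi))))

lemma measurable_card {α : Type*} [MeasurableSpace α] {S : α → Finset (Fin n)}
    (h : Measurable[_, ⊤] S) : Measurable fun a => (S a).card := by
  let : MeasurableSpace (Finset (Fin n)) := ⊤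
  exact (measurable_from_top (f := Finset.card)).comp h

lemma measurable_sInf_setOf {α : Type*} [MeasurableSpace α] {p : ℕ → α → Prop}
    (hp : ∀ b, MeasurableSet {a | p b a}) : Measurable fun a => sInf {b | p b a} := by
  classical
  refine measurable_to_countable' fun m => ?_
  -- The second set accounts for the default value `sInf ∅ = 0`.
  have : (fun a => sInf {b | p b a}) ⁻¹' {m} =
      {a | p m a ∧ ∀ k < m, ¬ p k a} ∪ {a | m = 0 ∧ ∀ k, ¬ p k a} := by
    ext a
    simp only [Set.mem_preimage, Set.mem_singleton_iff, Set.mem_union, Set.mem_ofPred_eq]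
    constructor
    · intro h
      by_cases hne : {b | p b a}.Nonempty
      · left
        have h1 := Nat.sInf_mem hne
        rw [h] at h1
        exact ⟨h1, fun k hk hpk => absurd (Nat.sInf_le (show k ∈ {b | p b a} from hpk)) (by lia)⟩
      · right
        rw [Set.not_nonempty_iff_eq_empty] at hne
        rw [hne, Nat.sInf_empty] at h
        exact ⟨h.symm, fun k hk => (hne ▸ (show k ∈ {b | p b a} from hk) : k ∈ (∅ : Set ℕ))⟩
    · rintro (⟨h1, h2⟩ | ⟨rfl, h⟩)
      · refine le_antisymm (Nat.sInf_le h1) (not_lt.1 fun hlt => h2 _ hlt ?_)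
        exact Nat.sInf_mem (s := {b | p b a}) ⟨m, h1⟩
      · have : {b | p b a} = ∅ := Set.eq_empty_of_forall_notMem h
        rw [this, Nat.sInf_empty]
  rw [this]
  have h1 : MeasurableSet {a | ∀ k < m, ¬ p k a} := by
    simp only [Set.ofPred_forall]
    exact MeasurableSet.iInter fun k => MeasurableSet.iInter fun _ => (hp k).compl
  have h2 : MeasurableSet {a | ∀ k, ¬ p k a} := by
    simp only [Set.ofPred_forall]
    exact MeasurableSet.iInter fun k => (hp k).compl
  exact ((hp m).inter h1).union ((MeasurableSet.const _).inter h2)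

lemma MeasurableState.medianBin (hs : MeasurableState s) :
    Measurable fun x => medianBin B x (s x) := by
  refine measurable_sInf_setOf fun b => (MeasurableSet.const _).inter ?_
  refine measurableSet_le measurable_const (hs.left.add ?_)
  exact Finset.measurable_fun_sum _ fun i _ => measurable_card (hs.bin i)

lemma measurable_sInf_image (S : Finset (Fin n)) :
    Measurable fun x : Fin n → ℝ => sInf (x '' (S : Set (Fin n))) := by
  simp only [sInf_image']
  exact Measurable.iInf fun i => measurable_pi_apply _

lemma measurable_sSup_image (S : Finset (Fin n)) :
    Measurable fun x : Fin n → ℝ => sSup (x '' (S : Set (Fin n))) := by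
  simp only [sSup_image']
  exact Measurable.iSup fun i => measurable_pi_apply _

lemma MeasurableState.step (hs : MeasurableState s) :
    MeasurableState fun x => step B x (s x) := by
  classical
  have hb := hs.medianBin (B := B)
  have hS : Measurable[_, ⊤] fun x => Binmedian.bin B x (s x) (Binmedian.medianBin B x (s x)) :=
    let : MeasurableSpace (Finset (Fin n)) := ⊤
    measurable_comp_countable (F := fun b x => Binmedian.bin B x (s x) b) hb fun b => hs.bin b
  have heq : MeasurableSet {x | Binmedian.bin B x (s x) (Binmedian.medianBin B x (s x))
      = (s x).pts} := by
    let : MeasurableSpace (Finset (Fin n)) := ⊤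
    have : DiscreteMeasurableSpace (Finset (Fin n)) := ⟨fun _ => trivial⟩
    exact measurableSet_eq_fun hS hs.pts
  refine ⟨?_, ?_, hS, ?_⟩
  · refine Measurable.ite heq ?_ ?_
    · exact measurable_comp_countable hS measurable_sInf_image
    · exact measurable_comp_countable hb fun b => measurable_edge hs.lo hs.hi b
  · refine Measurable.ite heq ?_ ?_
    · exact measurable_comp_countable hS measurable_sSup_image
    · exact measurable_comp_countable hb fun b => measurable_edge hs.lo hs.hi (b + 1)
  · refine hs.left.add (measurable_comp_countable hb
      (F := fun b x => ∑ i ∈ Finset.range b, (Binmedian.bin B x (s x) i).card) fun b => ?_)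
    exact Finset.measurable_fun_sum _ fun i _ => measurable_card (hs.bin i)

lemma measurableState_init : MeasurableState (init : (Fin n → ℝ) → State n) where
  lo := measurable_mean.sub measurable_stdDev
  hi := measurable_mean.add measurable_stdDev
  pts := by
    let : MeasurableSpace (Finset (Fin n)) := ⊤
    exact measurable_const
  left := by
    classical
    simp only [Binmedian.init]
    refine measurable_card (measurable_finset fun k => ?_)
    simp only [Finset.mem_filter, Finset.mem_univ, true_and]
    exact measurableSet_lt (measurable_pi_apply k) (measurable_mean.sub measurable_stdDev)

lemma measurableState_run (j : ℕ) :
    MeasurableState fun x : Fin n → ℝ => run B x j := by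
  induction j with
  | zero => exact measurableState_init
  | succ j ih => exact ih.step

lemma measurable_numPts (j : ℕ) : Measurable fun x : Fin n → ℝ => numPts B x j :=
  measurable_card (measurableState_run j).pts

lemma measurable_runtime : Measurable (runtime B : (Fin n → ℝ) → ℝ≥0∞) := by
  classical
  refine Measurable.tsum fun j => Measurable.ite ?_ ?_ measurable_const
  · simp only [coe_le_iterations, Set.ofPred_forall]
    refine MeasurableSet.iInter fun i => ?_
    have : MeasurableSet {x : Fin n → ℝ | numPts B x i ≤ 1} :=
      measurableSet_le (measurable_numPts i) measurable_const
    exact this.imp (MeasurableSet.const _)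
  · exact ((measurable_from_top (f := fun N : ℕ => (N : ℝ≥0∞))).comp (measurable_numPts j)).add measurable_const

end Measurability

/-! ### Expected close pairs, survivors and running time. -/

section Expectation

variable {f : ℝ → ℝ} {ν : Measure ℝ} {M : ℝ}

lemma measure_abs_sub_le (hM : ∀ y, f y ≤ M)
    (hν : ν = (volume : Measure ℝ).withDensity fun y => ENNReal.ofReal (f y)) (a w : ℝ) :
    ν {y | |a - y| ≤ w} ≤ ENNReal.ofReal M * ENNReal.ofReal (2 * w) := by
  have hset : {y | |a - y| ≤ w} = Metric.closedBall a w := by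
    ext y; simp [Real.dist_eq, abs_sub_comm]
  rw [hset, hν, withDensity_apply _ Metric.isClosed_closedBall.measurableSet]
  calc ∫⁻ y in Metric.closedBall a w, ENNReal.ofReal (f y)
      ≤ ∫⁻ _ in Metric.closedBall a w, ENNReal.ofReal M :=
        lintegral_mono fun y => ENNReal.ofReal_le_ofReal (hM y)
    _ = _ := by rw [setLIntegral_const, Real.volume_closedBall]

variable {n : ℕ} {Ω : Type*} [MeasurableSpace Ω] {P : Measure Ω} {X : Fin n → Ω → ℝ}

lemma measurable_closePairs (w : ℝ) : Measurable (closePairs w : (Fin n → ℝ) → ℝ) := by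
  classical
  refine Finset.measurable_fun_sum _ fun p _ => Measurable.ite ?_ measurable_const measurable_const
  exact measurableSet_le (by fun_prop) measurable_const

lemma lintegral_sum_sq {m : ℝ} (hm : ∫⁻ y, ENNReal.ofReal (y ^ 2) ∂ν = ENNReal.ofReal m)
    (hX : ∀ i, HasLaw (X i) ν P) :
    ∫⁻ ω, ENNReal.ofReal (∑ i, X i ω ^ 2) ∂P = n * ENNReal.ofReal m := by
  have haem : ∀ i, AEMeasurable (X i) P := fun i => (hX i).aemeasurable
  have hi : ∀ i, ∫⁻ ω, ENNReal.ofReal (X i ω ^ 2) ∂P = ENNReal.ofReal m := fun i => by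
    rw [← hm]
    exact (hX i).lintegral_comp (f := fun y => ENNReal.ofReal (y ^ 2)) (by fun_prop)
  simp_rw [ENNReal.ofReal_sum_of_nonneg fun i _ => sq_nonneg (X i _)]
  rw [lintegral_finsetSum' _ fun i _ => ((haem i).pow_const 2).ennreal_ofReal]
  simp [hi]

variable [IsProbabilityMeasure P]

/-- Independent variables with a density bounded by `M` are close with small probability. -/
lemma measure_abs_sub_le_of_indepFun [IsProbabilityMeasure ν] (hM : ∀ y, f y ≤ M)
    (hν : ν = (volume : Measure ℝ).withDensity fun y => ENNReal.ofReal (f y))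
    {X Y : Ω → ℝ} (hX : HasLaw X ν P) (hY : HasLaw Y ν P) (hXY : IndepFun X Y P) (w : ℝ) :
    P {ω | |X ω - Y ω| ≤ w} ≤ ENNReal.ofReal M * ENNReal.ofReal (2 * w) := by
  have hlaw : P.map (fun ω => (X ω, Y ω)) = ν.prod ν := by
    rw [(indepFun_iff_map_prod_eq_prod_map_map hX.aemeasurable hY.aemeasurable).1 hXY,
      hX.map_eq, hY.map_eq]
  have hmeas : MeasurableSet {p : ℝ × ℝ | |p.1 - p.2| ≤ w} :=
    measurableSet_le (by fun_prop) measurable_const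
  have h1 : P {ω | |X ω - Y ω| ≤ w} = (ν.prod ν) {p : ℝ × ℝ | |p.1 - p.2| ≤ w} := by
    rw [← hlaw, Measure.map_apply_of_aemeasurable
      (hX.aemeasurable.prodMk hY.aemeasurable) hmeas]
    rfl
  rw [h1, Measure.prod_apply hmeas]
  calc ∫⁻ a, ν (Prod.mk a ⁻¹' {p : ℝ × ℝ | |p.1 - p.2| ≤ w}) ∂ν
      ≤ ∫⁻ _, ENNReal.ofReal M * ENNReal.ofReal (2 * w) ∂ν :=
        lintegral_mono fun a => measure_abs_sub_le hM hν a w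
    _ = _ := by simp

/-- Linearity of expectation over at most `n ^ 2` pairs, each independent because its indices
differ. -/
lemma lintegral_closePairs_le [IsProbabilityMeasure ν] (hM : ∀ y, f y ≤ M)
    (hν : ν = (volume : Measure ℝ).withDensity fun y => ENNReal.ofReal (f y))
    (hX : ∀ i, HasLaw (X i) ν P) (hind : iIndepFun X P) (w : ℝ) :
    ∫⁻ ω, ENNReal.ofReal (closePairs w fun i => X i ω) ∂P
      ≤ (n : ℝ≥0∞) ^ 2 * (ENNReal.ofReal M * ENNReal.ofReal (2 * w)) := by
  classical
  have haem : ∀ i, AEMeasurable (X i) P := fun i => (hX i).aemeasurable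
  have hset : ∀ p : Fin n × Fin n, NullMeasurableSet {ω | |X p.1 ω - X p.2 ω| ≤ w} P := fun p =>
    nullMeasurableSet_le (((haem p.1).sub (haem p.2)).abs) aemeasurable_const
  have hrw : ∀ ω, ENNReal.ofReal (closePairs w fun i => X i ω) =
      ∑ p ∈ (Finset.univ : Finset (Fin n)).offDiag,
        {ω | |X p.1 ω - X p.2 ω| ≤ w}.indicator (fun _ => (1 : ℝ≥0∞)) ω := by
    intro ω
    unfold closePairs
    rw [ENNReal.ofReal_sum_of_nonneg fun p _ => by split_ifs <;> norm_num]
    refine Finset.sum_congr rfl fun p _ => ?_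
    by_cases h : |X p.1 ω - X p.2 ω| ≤ w <;> simp [Set.indicator, h]
  simp only [hrw]
  rw [lintegral_finsetSum' _ fun p _ => (aemeasurable_const.indicator₀ (hset p))]
  calc _ ≤ ∑ p ∈ (Finset.univ : Finset (Fin n)).offDiag,
        ENNReal.ofReal M * ENNReal.ofReal (2 * w) := by
        refine Finset.sum_le_sum fun p hp => ?_
        rw [lintegral_indicator_const₀ (hset p), one_mul]
        exact measure_abs_sub_le_of_indepFun hM hν (hX _) (hX _)
          (hind.indepFun (Finset.mem_offDiag.1 hp).2.2) w
    _ ≤ _ := by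
        rw [Finset.sum_const, nsmul_eq_mul]
        gcongr
        have : (Finset.univ : Finset (Fin n)).offDiag.card ≤ n ^ 2 := by
          rw [Finset.offDiag_card, Finset.card_univ, Fintype.card_fin, sq]
          exact Nat.sub_le _ _
        exact_mod_cast this

lemma lintegral_numPts_le [IsProbabilityMeasure ν] {B : ℕ} (hB : 2 ≤ B) (hn : 0 < n)
    (hM0 : 0 ≤ M) (hM : ∀ y, f y ≤ M)
    (hν : ν = (volume : Measure ℝ).withDensity fun y => ENNReal.ofReal (f y))
    {m : ℝ} (hm0 : 0 ≤ m) (hm : ∫⁻ y, ENNReal.ofReal (y ^ 2) ∂ν = ENNReal.ofReal m)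
    (hX : ∀ i, HasLaw (X i) ν P) (hind : iIndepFun X P) (j : ℕ) :
    ∫⁻ ω, (if 2 ≤ numPts B (fun i => X i ω) j then (numPts B (fun i => X i ω) j : ℝ≥0∞) else 0) ∂P
      ≤ ENNReal.ofReal (n * (m * (16 / 25) ^ j + (3 / 4) ^ j + 8 * M * (5 / 6) ^ j)) := by
  have haem : ∀ i, AEMeasurable (X i) P := fun i => (hX i).aemeasurable
  have hvec : AEMeasurable (fun ω i => X i ω) P := aemeasurable_pi_lambda _ haem
  have hn' : (0 : ℝ) < n := by exact_mod_cast hn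
  have hr : (0 : ℝ) < n * (3 / 4) ^ j := by positivity
  have hpt : ∀ ω, (if 2 ≤ numPts B (fun i => X i ω) j
      then (numPts B (fun i => X i ω) j : ℝ≥0∞) else 0) ≤
      ENNReal.ofReal ((16 / 25) ^ j) * ENNReal.ofReal (∑ i, X i ω ^ 2)
        + ENNReal.ofReal (n * (3 / 4) ^ j)
        + ENNReal.ofReal (2 / (n * (3 / 4) ^ j)) *
          ENNReal.ofReal (closePairs (2 * (5 / 8) ^ j) fun i => X i ω) := by
    intro ω
    split_ifs with h2
    · have hq : 0 ≤ ∑ i, X i ω ^ 2 := Finset.sum_nonneg fun i _ => sq_nonneg _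
      have hc := closePairs_nonneg (2 * (5 / 8) ^ j) fun i => X i ω
      rw [← ENNReal.ofReal_mul (by positivity), ← ENNReal.ofReal_mul (by positivity),
        ← ENNReal.ofReal_add (by positivity) (by positivity),
        ← ENNReal.ofReal_add (by positivity) (by positivity), ← ENNReal.ofReal_natCast]
      exact ENNReal.ofReal_le_ofReal (numPts_le_closePairs hB hn _ j h2)
    · exact zero_le
  refine (lintegral_mono hpt).trans ?_
  have hcm : AEMeasurable (fun ω =>
      ENNReal.ofReal (closePairs (2 * (5 / 8) ^ j) fun i => X i ω)) P :=
    ((measurable_closePairs _).comp_aemeasurable hvec).ennreal_ofReal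
  have hsm : AEMeasurable (fun ω => ENNReal.ofReal (∑ i, X i ω ^ 2)) P := by fun_prop
  rw [lintegral_add_right' _ (hcm.const_mul _), lintegral_add_right' _ aemeasurable_const,
    lintegral_const_mul'' _ hsm, lintegral_const_mul'' _ hcm, lintegral_const, measure_univ,
    mul_one, lintegral_sum_sq hm hX]
  refine (add_le_add le_rfl (mul_le_mul' le_rfl
    (lintegral_closePairs_le hM hν hX hind _))).trans ?_
  rw [← ENNReal.ofReal_natCast n, ← ENNReal.ofReal_pow hn'.le, ← ENNReal.ofReal_mul hn'.le,
    ← ENNReal.ofReal_mul (by positivity), ← ENNReal.ofReal_mul hM0,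
    ← ENNReal.ofReal_mul (by positivity), ← ENNReal.ofReal_mul (by positivity),
    ← ENNReal.ofReal_add (by positivity) (by positivity),
    ← ENNReal.ofReal_add (by positivity) (by positivity)]
  refine ENNReal.ofReal_le_ofReal (le_of_eq ?_)
  -- The factor `(3/4) ^ j` cancels the threshold in the denominator, leaving decay `(5/6) ^ j`; the
  -- constant is `8 = 2 * 2 * 2`, from `2 / r`, `2 * w` and `w = 2 (5/8) ^ j`.
  have hpow : (5 / 8 : ℝ) ^ j = (3 / 4) ^ j * (5 / 6) ^ j := by
    rw [← mul_pow]; norm_num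
  rw [hpow]
  field_simp
  ring

lemma lintegral_runtime_le [IsProbabilityMeasure ν] {B : ℕ} (hB : 2 ≤ B) (hn : 0 < n)
    (hM0 : 0 ≤ M) (hM : ∀ y, f y ≤ M)
    (hν : ν = (volume : Measure ℝ).withDensity fun y => ENNReal.ofReal (f y))
    {m : ℝ} (hm0 : 0 ≤ m) (hm : ∫⁻ y, ENNReal.ofReal (y ^ 2) ∂ν = ENNReal.ofReal m)
    (hX : ∀ i, HasLaw (X i) ν P) (hind : iIndepFun X P) :
    ∫⁻ ω, runtime B (fun i => X i ω) ∂P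
      ≤ ENNReal.ofReal ((1 + B) * (5 + 25 / 9 * m + 48 * M)) * n := by
  have hvec : AEMeasurable (fun ω i => X i ω) P :=
    aemeasurable_pi_lambda _ fun i => (hX i).aemeasurable
  have hn1 : (1 : ℝ) ≤ n := by exact_mod_cast hn
  have hmeas : ∀ j, AEMeasurable (fun ω => (if 2 ≤ numPts B (fun i => X i ω) j
      then (numPts B (fun i => X i ω) j : ℝ≥0∞) else 0)) P := fun j =>
    (measurable_from_top (f := fun N : ℕ => if 2 ≤ N then (N : ℝ≥0∞) else 0)).comp_aemeasurable
      ((measurable_numPts (B := B) j).comp_aemeasurable hvec)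
  have hgeo : HasSum (fun j : ℕ => (n : ℝ) * (m * (16 / 25) ^ j + (3 / 4) ^ j + 8 * M * (5 / 6) ^ j))
      (n * (m * (1 - 16 / 25)⁻¹ + (1 - 3 / 4)⁻¹ + 8 * M * (1 - 5 / 6)⁻¹)) :=
    ((((hasSum_geometric_of_lt_one (by norm_num) (by norm_num)).mul_left m).add
      (hasSum_geometric_of_lt_one (by norm_num) (by norm_num))).add
      ((hasSum_geometric_of_lt_one (by norm_num) (by norm_num)).mul_left (8 * M))).mul_left _
  have hnn : ∀ j : ℕ, 0 ≤ (n : ℝ) * (m * (16 / 25) ^ j + (3 / 4) ^ j + 8 * M * (5 / 6) ^ j) :=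
    fun j => by positivity
  have hsum : ∑' j, ∫⁻ ω, (if 2 ≤ numPts B (fun i => X i ω) j
      then (numPts B (fun i => X i ω) j : ℝ≥0∞) else 0) ∂P
      ≤ ENNReal.ofReal (n * (4 + 25 / 9 * m + 48 * M)) := by
    refine (ENNReal.tsum_le_tsum fun j =>
      lintegral_numPts_le hB hn hM0 hM hν hm0 hm hX hind j).trans ?_
    rw [← ENNReal.ofReal_tsum_of_nonneg hnn hgeo.summable, hgeo.tsum_eq]
    refine ENNReal.ofReal_le_ofReal (le_of_eq ?_)
    ring
  have hB1 : (1 + B : ℝ≥0∞) = ENNReal.ofReal (1 + B) := by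
    rw [ENNReal.ofReal_add zero_le_one (Nat.cast_nonneg _)]; simp
  calc ∫⁻ ω, runtime B (fun i => X i ω) ∂P
      ≤ ∫⁻ ω, ((1 + B) + ∑' j, (1 + B) * (if 2 ≤ numPts B (fun i => X i ω) j
        then (numPts B (fun i => X i ω) j : ℝ≥0∞) else 0)) ∂P :=
        lintegral_mono fun ω => runtime_le _
    _ = (1 + B) + ∑' j, (1 + B) * ∫⁻ ω, (if 2 ≤ numPts B (fun i => X i ω) j
        then (numPts B (fun i => X i ω) j : ℝ≥0∞) else 0) ∂P := by
        rw [lintegral_add_left' aemeasurable_const,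
          lintegral_tsum fun j => (hmeas j).const_mul _]
        simp only [lintegral_const, measure_univ, mul_one]
        congr 1
        exact tsum_congr fun j => lintegral_const_mul'' _ (hmeas j)
    _ ≤ (1 + B) + (1 + B) * ENNReal.ofReal (n * (4 + 25 / 9 * m + 48 * M)) := by
        rw [ENNReal.tsum_mul_left]
        gcongr
    _ ≤ _ := by
        rw [hB1, ← ENNReal.ofReal_natCast n, ← ENNReal.ofReal_mul (by positivity),
          ← ENNReal.ofReal_mul (by positivity),
          ← ENNReal.ofReal_add (by positivity) (by positivity)]
        refine ENNReal.ofReal_le_ofReal ?_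
        have hB0 : (0 : ℝ) ≤ 1 + B := by positivity
        -- The terminal cost `1 + B` is absorbed into `(1 + B) * n`, turning the `4` into `5`.
        nlinarith [mul_le_mul_of_nonneg_left hn1 hB0]

end Expectation

end Binmedian

end

theorem mainTheorem2
    (B : ℕ) (hB : 2 ≤ B)
    (f : ℝ → ℝ) (hf_meas : Measurable f) (hf_nonneg : ∀ y, 0 ≤ f y)
    (hf_bdd : ∃ M : ℝ, ∀ y, f y ≤ M)
    (ν : Measure ℝ) [IsProbabilityMeasure ν]
    (hν : ν = (volume : Measure ℝ).withDensity fun y => ENNReal.ofReal (f y))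
    (h4 : Integrable (fun y : ℝ => y ^ 4) ν) :
    ∃ K : ℝ≥0, ∀ n : ℕ, Odd n →
      ∀ (Ω : Type*) [MeasurableSpace Ω] (P : Measure Ω) [IsProbabilityMeasure P]
        (X : Fin n → Ω → ℝ),
        (∀ i, HasLaw (X i) ν P) → iIndepFun X P →
        AEMeasurable (fun ω => Binmedian.runtime B fun i => X i ω) P ∧
          ∫⁻ ω, Binmedian.runtime B (fun i => X i ω) ∂P ≤ (K : ℝ≥0∞) * (n : ℝ≥0∞) := by
  obtain ⟨M, hM⟩ := hf_bdd
  have hM0 : 0 ≤ M := (hf_nonneg 0).trans (hM 0)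
  have h2 : Integrable (fun y : ℝ => y ^ 2) ν := by
    refine ((integrable_const (1 : ℝ)).add h4).mono' (by fun_prop) (.of_forall fun y => ?_)
    rw [Real.norm_of_nonneg (sq_nonneg y)]
    change y ^ 2 ≤ 1 + y ^ 4
    nlinarith [sq_nonneg (y ^ 2 - 1)]
  have hm : ∫⁻ y, ENNReal.ofReal (y ^ 2) ∂ν = ENNReal.ofReal (∫ y, y ^ 2 ∂ν) :=
    (ofReal_integral_eq_lintegral_ofReal h2 (.of_forall fun y => sq_nonneg y)).symm
  refine ⟨((1 + B) * (5 + 25 / 9 * (∫ y, y ^ 2 ∂ν) + 48 * M)).toNNReal,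
    fun n hn Ω _ P _ X hX hind => ⟨?_, ?_⟩⟩
  · exact Binmedian.measurable_runtime.comp_aemeasurable
      (aemeasurable_pi_lambda _ fun i => (hX i).aemeasurable)
  · exact Binmedian.lintegral_runtime_le hB hn.pos hM0 hM hν
      (integral_nonneg fun y => sq_nonneg y) hm hX hind
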